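/- Let $m\ge 1$ be an integer and $\boldsymbol p=(p_0,\dots,p_{m-1})\in(0,1)^m$. A cyclic birth–death chain with parameters $\boldsymbol p$ is a discrete-time, time-homogeneous Markov chain $X=(X_n)_{n\ge 0}$ on $\mathbb Z$, with an arbitrary initial distribution, whose transition probabilities are $p_{i,i+1}=p_{i \bmod m}$ and $p_{i,i-1}=1-p_{i \bmod m}$ for every $i\in\mathbb Z$ (all others being zero). Put $$\gamma=\prod_{i=0}^{m-1}\frac{1-p_i}{p_i}.$$ Then there is a real number $v=v(\boldsymbol p)$, depending only on $\boldsymbol p$, such that for every cyclic birth–death chain $X$ with parameters $\boldsymbol p$, almost surely $\lim_{n\to\infty}X_n/n=v$. Moreover, - $v>0$ if and only if $\gamma<1$; - $v<0$ if and only if $\gamma>1$; - for every such chain $X$: $v=0$ and $X$ is recurrent (that is, almost surely $X_n=0$ for infinitely many $n$) if and only if $\gamma=1$. -/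

import Mathlib

open MeasureTheory Filter Topology

/-- `X` is a time-homogeneous discrete-time Markov chain on the countable state space `S` with
transition probabilities `P i j`, under the measure `μ`, with an arbitrary initial law: whenever the
history `X 0 = x 0, …, X n = x n` has positive probability, the conditional probability of
`X (n + 1) = x (n + 1)` given that history is `P (x n) (x (n + 1))`. The condition is written with
the conditional probability multiplied out (it is trivially true for histories of probability
zero). -/
structure IsMarkovChain {S Ω : Type*} [MeasurableSpace S] [MeasurableSpace Ω]
    (P : S → S → ℝ) (μ : Measure Ω) (X : ℕ → Ω → S) : Prop where
  measurable : ∀ n, Measurable (X n)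
  transition : ∀ (n : ℕ) (x : ℕ → S),
    μ.real {ω | ∀ k ≤ n + 1, X k ω = x k}
      = μ.real {ω | ∀ k ≤ n, X k ω = x k} * P (x n) (x (n + 1))

/-- The periodic extension `i ↦ p_{i mod m}` of `p_0, …, p_{m-1}` to all integers `i`. -/
def cyclicExtension {m : ℕ} [NeZero m] (p : Fin m → ℝ) (i : ℤ) : ℝ :=
  p ⟨(i % (m : ℤ)).toNat, by
    have hm : (0 : ℤ) < m := by exact_mod_cast Nat.pos_of_ne_zero (NeZero.ne m)
    have h₀ := Int.emod_nonneg i hm.ne'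
    have h₁ := Int.emod_lt_of_pos i hm
    omega⟩

/-- Transition probabilities on `ℤ`: from `i` to `i + 1` with probability `p_{i mod m}`, from `i`
to `i - 1` with probability `1 - p_{i mod m}`. -/
def cyclicTransition {m : ℕ} [NeZero m] (p : Fin m → ℝ) (i j : ℤ) : ℝ :=
  if j = i + 1 then cyclicExtension p i
  else if j = i - 1 then 1 - cyclicExtension p i
  else 0

/-- `X` is a cyclic birth and death chain on `ℤ` with parameters `p_0, …, p_{m-1}`. -/
def IsCyclicBirthDeathChain {m : ℕ} [NeZero m] (p : Fin m → ℝ) {Ω : Type*} [MeasurableSpace Ω]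
    (μ : Measure Ω) (X : ℕ → Ω → ℤ) : Prop :=
  IsMarkovChain (cyclicTransition p) μ X

/-- `γ = ∏ ρ_i` with `ρ_i = (1 - p_i) / p_i`. -/
noncomputable def cyclicGamma {m : ℕ} (p : Fin m → ℝ) : ℝ :=
  ∏ i, (1 - p i) / p i

/-- The process visits `0` infinitely often, with probability one. -/
def IsRecurrentProcess {Ω : Type*} [MeasurableSpace Ω] (μ : Measure Ω) (X : ℕ → Ω → ℤ) : Prop :=
  ∀ᵐ ω ∂μ, ∃ᶠ n in atTop, X n ω = 0

/-! Change coordinates so that the drift becomes constant. `exists_harmonic_coordinate` gives an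
increasing `h`, with `h - id` bounded, such that one step of the chain raises `h` by `v` on average.
Its increments solve a first-order linear recursion whose periodic solution, up to scale, has drift
`1 - γ`; positive rescaling keeps the sign, so the sign of `v` is read off from `γ`.

Then `h (X n) - h (X 0) - n v` is a martingale with bounded increments. Orthogonality makes its
second moment O(n), so it is o(n) almost surely, first along squares and then everywhere, and `X n /
n` tends to `v`.

If `γ = 1`, then `v = 0` and the martingale moves by at least `δ` at each step, so it cannot
converge. Bounded increments then make it unbounded on both sides, and a nearest-neighbour path with
this property keeps returning to 0. -/

section Corrector

/-! ### The coordinate with constant drift. -/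

variable {m : ℕ} [NeZero m] {p : Fin m → ℝ}

lemma cyclicExtension_mem (hp : ∀ i, p i ∈ Set.Ioo (0 : ℝ) 1) (i : ℤ) :
    cyclicExtension p i ∈ Set.Ioo (0 : ℝ) 1 := hp _

lemma cyclicExtension_emod (i : ℤ) : cyclicExtension p (i % (m : ℤ)) = cyclicExtension p i := by
  simp [cyclicExtension]

/-- The product of the ratios `(1 - p_j) / p_j` over `j < k`. -/
noncomputable def ratioProd (p : Fin m → ℝ) (k : ℕ) : ℝ :=
  ∏ j ∈ Finset.range k, (1 - cyclicExtension p j) / cyclicExtension p j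

/-- The partial sums of `1 / (p_j γ_{j + 1})`, where `γ_j` is `ratioProd p j`. -/
noncomputable def ratioSum (p : Fin m → ℝ) (k : ℕ) : ℝ :=
  ∑ j ∈ Finset.range k, 1 / (cyclicExtension p j * ratioProd p (j + 1))

/-- The increments, up to normalization, of the harmonic coordinate of the chain over a period. -/
noncomputable def harmonicIncrement (p : Fin m → ℝ) (k : ℕ) : ℝ :=
  ratioProd p k * (ratioProd p m * (ratioSum p m - ratioSum p k) + ratioSum p k)

lemma ratioProd_eq_cyclicGamma : ratioProd p m = cyclicGamma p := by
  rw [ratioProd, cyclicGamma, Finset.prod_range]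
  refine Finset.prod_congr rfl fun i _ => ?_
  have h : cyclicExtension p ((i : ℕ) : ℤ) = p i := by
    unfold cyclicExtension
    congr 1
    ext
    have hi : ((i : ℕ) : ℤ) % (m : ℤ) = (i : ℕ) :=
      Int.emod_eq_of_lt (by positivity) (by exact_mod_cast i.2)
    simp [hi]
  rw [h]

lemma ratioProd_pos (hp : ∀ i, p i ∈ Set.Ioo (0 : ℝ) 1) (k : ℕ) : 0 < ratioProd p k :=
  Finset.prod_pos fun j _ =>
    div_pos (sub_pos.2 (cyclicExtension_mem hp j).2) (cyclicExtension_mem hp j).1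

lemma ratioSum_strictMono (hp : ∀ i, p i ∈ Set.Ioo (0 : ℝ) 1) : StrictMono (ratioSum p) := by
  refine strictMono_nat_of_lt_succ fun k => ?_
  rw [ratioSum, ratioSum, Finset.sum_range_succ]
  have := mul_pos (cyclicExtension_mem hp k).1 (ratioProd_pos hp (k + 1))
  have : 0 < 1 / (cyclicExtension p k * ratioProd p (k + 1)) := by positivity
  linarith

lemma harmonicIncrement_pos (hp : ∀ i, p i ∈ Set.Ioo (0 : ℝ) 1) {k : ℕ} (hk : k ≤ m) :
    0 < harmonicIncrement p k := by
  have hS := ratioSum_strictMono hp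
  have h0 : ratioSum p 0 = 0 := by simp [ratioSum]
  have hG := ratioProd_pos hp m
  refine mul_pos (ratioProd_pos hp k) ?_
  rcases Nat.eq_zero_or_pos k with rfl | hk0
  · have := hS (Nat.pos_of_ne_zero (NeZero.ne m))
    rw [h0] at this ⊢
    simpa using mul_pos hG this
  · have h1 := hS hk0
    have h2 := hS.monotone hk
    rw [h0] at h1
    have := mul_nonneg hG.le (sub_nonneg.2 h2)
    linarith

/-- This recursion expresses drift `1 - γ`. Variation of constants gives `γ_k (d₀ + (1 - γ) S_k)`,
and periodicity is met by `d₀ = γ S_m`. Regrouped as in `harmonicIncrement`, it is visibly positive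
and needs no separate case `γ = 1`. -/
lemma harmonicIncrement_succ (hp : ∀ i, p i ∈ Set.Ioo (0 : ℝ) 1) (k : ℕ) :
    cyclicExtension p k * harmonicIncrement p (k + 1)
      = (1 - cyclicExtension p k) * harmonicIncrement p k + (1 - cyclicGamma p) := by
  have hk := (cyclicExtension_mem hp k).1
  have hR := ratioProd_pos hp (k + 1)
  have e1 : cyclicExtension p k * ratioProd p (k + 1)
      = (1 - cyclicExtension p k) * ratioProd p k := by
    rw [ratioProd, Finset.prod_range_succ, ← ratioProd]
    field_simp
  have e2 : cyclicExtension p k * ratioProd p (k + 1) * (ratioSum p (k + 1) - ratioSum p k) = 1 := by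
    rw [ratioSum, ratioSum, Finset.sum_range_succ]
    have := mul_pos hk hR
    rw [add_sub_cancel_left]
    field_simp
  rw [← ratioProd_eq_cyclicGamma, harmonicIncrement, harmonicIncrement]
  linear_combination (ratioProd p m * (ratioSum p m - ratioSum p k) + ratioSum p k) * e1
    + (1 - ratioProd p m) * e2

lemma harmonicIncrement_period : harmonicIncrement p m = harmonicIncrement p 0 := by
  simp [harmonicIncrement, ratioSum, ratioProd]

/-- A coordinate `h` at bounded distance from the identity, increasing, and in which the chain has
constant drift `v`. -/
theorem exists_harmonic_coordinate (hp : ∀ i, p i ∈ Set.Ioo (0 : ℝ) 1) :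
    ∃ (h : ℤ → ℝ) (v δ c : ℝ), (0 < v ↔ cyclicGamma p < 1) ∧ (v < 0 ↔ 1 < cyclicGamma p) ∧
      (∀ i, cyclicExtension p i * h (i + 1) + (1 - cyclicExtension p i) * h (i - 1) = h i + v) ∧
      0 < δ ∧ (∀ i, δ ≤ h (i + 1) - h i) ∧ ∀ i, |h i - i| ≤ c := by
  have hm : (0 : ℤ) < m := by exact_mod_cast Nat.pos_of_ne_zero (NeZero.ne m)
  set H : ℕ → ℝ := fun n => ∑ k ∈ Finset.range n, harmonicIncrement p (k + 1) with hH
  have hHs (n : ℕ) : H (n + 1) = H n + harmonicIncrement p (n + 1) := Finset.sum_range_succ _ _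
  have hD : 0 < H m := Finset.sum_pos
    (fun k hk => harmonicIncrement_pos hp (Finset.mem_range.1 hk))
    ⟨0, Finset.mem_range.2 (Nat.pos_of_ne_zero (NeZero.ne m))⟩
  -- Normalized so that `h` gains exactly `m` over a period, which makes `h - id` periodic and hence
  -- bounded.
  set t : ℝ := m / H m with ht
  have htp : 0 < t := div_pos (by exact_mod_cast hm) hD
  have htm : t * H m = m := by rw [ht]; field_simp
  set h : ℤ → ℝ := fun i => t * H (i % m).toNat + ((i / (m : ℤ) : ℤ) : ℝ) * m with hh
  have key (i : ℤ) : ∃ r : ℕ, r < m ∧ i % (m : ℤ) = r :=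
    ⟨(i % m).toNat, by have := Int.emod_lt_of_pos i hm; have := Int.emod_nonneg i hm.ne'; omega,
      by have := Int.emod_nonneg i hm.ne'; omega⟩
  have inc (i : ℤ) (r : ℕ) (hr : r < m) (hi : i % (m : ℤ) = r) :
      h (i + 1) - h i = t * harmonicIncrement p (r + 1) := by
    have hdm := Int.mul_ediv_add_emod i m
    rw [hi] at hdm
    rcases Nat.lt_or_ge (r + 1) m with hlt | hge
    · have e : i + 1 = ((r + 1 : ℕ) : ℤ) + (m : ℤ) * (i / m) := by push_cast; linarith
      have e1 : (i + 1) % (m : ℤ) = ((r + 1 : ℕ) : ℤ) := by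
        rw [e, Int.add_mul_emod_self_left]
        exact Int.emod_eq_of_lt (by positivity) (by exact_mod_cast hlt)
      have e2 : (i + 1) / (m : ℤ) = i / m := by
        conv_lhs => rw [e]
        rw [Int.add_mul_ediv_left _ _ hm.ne', Int.ediv_eq_zero_of_lt (by positivity)
          (by exact_mod_cast hlt), zero_add]
      simp only [hh, e1, e2, hi, Int.toNat_natCast, hHs]
      ring
    · have hrm : r + 1 = m := by omega
      have e : i + 1 = (m : ℤ) * (i / m + 1) := by
        have : ((r : ℤ) + 1) = m := by exact_mod_cast hrm
        linarith
      have e1 : (i + 1) % (m : ℤ) = 0 := by rw [e]; exact Int.mul_emod_right _ _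
      have e2 : (i + 1) / (m : ℤ) = i / m + 1 := by
        conv_lhs => rw [e]
        exact Int.mul_ediv_cancel_left _ hm.ne'
      have e3 : H m = H r + harmonicIncrement p (r + 1) := by rw [← hHs, hrm]
      have e4 : H 0 = 0 := by simp [hH]
      simp only [hh, e1, e2, hi, Int.toNat_natCast, Int.toNat_zero, e4]
      push_cast
      linear_combination t * e3 - htm
  obtain ⟨δ, hδ, hδ'⟩ : ∃ δ > 0, ∀ r < m, δ ≤ t * harmonicIncrement p (r + 1) := by
    have hne : (Finset.range m).Nonempty :=
      ⟨0, Finset.mem_range.2 (Nat.pos_of_ne_zero (NeZero.ne m))⟩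
    obtain ⟨r, hr, hmin⟩ := Finset.exists_min_image (Finset.range m)
      (fun r => t * harmonicIncrement p (r + 1)) hne
    exact ⟨_, mul_pos htp (harmonicIncrement_pos hp (Finset.mem_range.1 hr)),
      fun s hs => hmin s (Finset.mem_range.2 hs)⟩
  refine ⟨h, t * (1 - cyclicGamma p), δ, ∑ r ∈ Finset.range m, |t * H r - r|, ?_, ?_, ?_, hδ, ?_, ?_⟩
  · rw [mul_pos_iff_of_pos_left htp, sub_pos]
  · rw [← neg_pos, ← mul_neg, mul_pos_iff_of_pos_left htp, neg_sub, sub_pos]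
  · intro i
    obtain ⟨r, hr, hi⟩ := key i
    have h1 := inc i r hr hi
    have h2 : h i - h (i - 1) = t * harmonicIncrement p r := by
      obtain ⟨s, hs, hs'⟩ := key (i - 1)
      have h3 := inc (i - 1) s hs hs'
      rw [sub_add_cancel] at h3
      have h4 : ((s : ℤ) + 1) % m = r := by
        rw [← hi, ← hs', Int.emod_add_emod, sub_add_cancel]
      have h5 : (s + 1) % m = r := by exact_mod_cast h4
      rw [h3]
      -- At the wrap-around the left increment has index `m` rather than 0; periodicity identifies
      -- the two.
      rcases Nat.lt_or_ge (s + 1) m with hlt | hge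
      · rw [Nat.mod_eq_of_lt hlt] at h5
        rw [h5]
      · have : s + 1 = m := by omega
        rw [this, Nat.mod_self] at h5
        rw [this, ← h5, harmonicIncrement_period]
    have h3 := harmonicIncrement_succ hp r
    have h4 : cyclicExtension p (r : ℤ) = cyclicExtension p i := by
      rw [← hi, cyclicExtension_emod]
    rw [h4] at h3
    linear_combination cyclicExtension p i * h1 - (1 - cyclicExtension p i) * h2 + t * h3
  · intro i
    obtain ⟨r, hr, hi⟩ := key i
    rw [inc i r hr hi]
    exact hδ' r hr
  · intro i
    obtain ⟨r, hr, hi⟩ := key i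
    have hdm : ((m * (i / m) + i % m : ℤ) : ℝ) = i := by rw [Int.mul_ediv_add_emod]
    rw [hi] at hdm
    push_cast at hdm
    have e : h i - i = t * H r - r := by
      simp only [hh, hi, Int.toNat_natCast]
      linear_combination hdm
    rw [e]
    exact Finset.single_le_sum (f := fun r : ℕ => |t * H r - r|) (fun _ _ => abs_nonneg _)
      (Finset.mem_range.2 hr)

end Corrector

/-! ### Two deterministic facts about sequences. -/

/-- Unit steps cannot jump over 0, so a path avoiding 0 from some time on keeps its sign and is
bounded on one side. -/
lemma Int.frequently_eq_zero_of_unbounded {x : ℕ → ℤ}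
    (hx : ∀ n, x (n + 1) = x n + 1 ∨ x (n + 1) = x n - 1)
    (ha : ¬ BddAbove (Set.range x)) (hb : ¬ BddBelow (Set.range x)) :
    ∃ᶠ n in atTop, x n = 0 := by
  rw [frequently_atTop]
  by_contra! hcon
  obtain ⟨N, hN⟩ := hcon
  rcases lt_or_gt_of_ne (hN N le_rfl) with h | h
  · refine ha (IsBoundedUnder.bddAbove_range ⟨0, ?_⟩)
    refine eventually_map.2 (eventually_atTop.2 ⟨N, fun n hn => ?_⟩)
    suffices x n < 0 from this.le
    induction n, hn using Nat.le_induction with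
    | base => exact h
    | succ n hn ih =>
      have := hN (n + 1) (by omega)
      have := hx n
      omega
  · refine hb (IsBoundedUnder.bddBelow_range ⟨0, ?_⟩)
    refine eventually_map.2 (eventually_atTop.2 ⟨N, fun n hn => ?_⟩)
    suffices 0 < x n from this.le
    induction n, hn using Nat.le_induction with
    | base => exact h
    | succ n hn ih =>
      have := hN (n + 1) (by omega)
      have := hx n
      omega

/-- Since `n` exceeds the largest square below it by at most `2 √n`, interpolation costs at most `2
K √n`, which is negligible against `n`. -/
lemma tendsto_div_of_tendsto_sq {a : ℕ → ℝ} {K : ℝ} (hK : ∀ n, |a (n + 1) - a n| ≤ K)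
    (h : Tendsto (fun n : ℕ => a (n ^ 2) / (n : ℝ) ^ 2) atTop (𝓝 0)) :
    Tendsto (fun n : ℕ => a n / n) atTop (𝓝 0) := by
  have hK0 : 0 ≤ K := (abs_nonneg _).trans (hK 0)
  have hstep (n k : ℕ) : |a (n + k) - a n| ≤ k * K := by
    induction k with
    | zero => simp
    | succ k ih =>
      have e : a (n + (k + 1)) - a n = (a (n + k + 1) - a (n + k)) + (a (n + k) - a n) := by
        rw [← add_assoc]; ring
      rw [e]
      refine (abs_add_le _ _).trans ?_
      have := hK (n + k)
      push_cast
      linarith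
  have hs : Tendsto Nat.sqrt atTop atTop :=
    tendsto_atTop.2 fun b => eventually_atTop.2 ⟨b * b, fun n hn => Nat.le_sqrt.2 hn⟩
  have h1 : Tendsto (fun n : ℕ => |a (n ^ 2) / (n : ℝ) ^ 2| + 2 * K / n) atTop (𝓝 0) := by
    simpa using h.abs.add (tendsto_const_div_atTop_nhds_zero_nat (2 * K))
  refine squeeze_zero_norm' ?_ (h1.comp hs)
  filter_upwards [eventually_ge_atTop 1] with n hn
  have hspos : 0 < Nat.sqrt n := Nat.sqrt_pos.2 hn
  have h2 : n ≤ Nat.sqrt n ^ 2 + 2 * Nat.sqrt n := by have := Nat.sqrt_le_add n; nlinarith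
  have h3 : Nat.sqrt n ^ 2 ≤ n := Nat.sqrt_le' n
  obtain ⟨k, hk⟩ := Nat.exists_eq_add_of_le h3
  have h4 := hstep (Nat.sqrt n ^ 2) k
  rw [← hk] at h4
  have hk2 : (k : ℝ) ≤ 2 * Nat.sqrt n := by exact_mod_cast (by omega : k ≤ 2 * Nat.sqrt n)
  have h5 : |a n| ≤ |a (Nat.sqrt n ^ 2)| + 2 * Nat.sqrt n * K := by
    have e := abs_sub_abs_le_abs_sub (a n) (a (Nat.sqrt n ^ 2))
    have := mul_le_mul_of_nonneg_right hk2 hK0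
    linarith
  have hs' : (0 : ℝ) < Nat.sqrt n := by exact_mod_cast hspos
  have h3' : (Nat.sqrt n : ℝ) ^ 2 ≤ n := by exact_mod_cast h3
  have e : |a (Nat.sqrt n ^ 2) / (Nat.sqrt n : ℝ) ^ 2| + 2 * K / Nat.sqrt n
      = (|a (Nat.sqrt n ^ 2)| + 2 * Nat.sqrt n * K) / (Nat.sqrt n : ℝ) ^ 2 := by
    rw [abs_div, abs_of_pos (by positivity : (0 : ℝ) < (Nat.sqrt n : ℝ) ^ 2)]
    field_simp
  simp only [Function.comp]
  rw [e, Real.norm_eq_abs, abs_div, Nat.abs_cast]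
  exact div_le_div₀ (by positivity) h5 (by positivity) h3'

/-! ### The compensated martingale. -/

section Chain

/-- The trajectory of the process up to time `n`. -/
def history {Ω : Type*} (X : ℕ → Ω → ℤ) (n : ℕ) (ω : Ω) : Fin (n + 1) → ℤ := fun k => X k ω

/-- The compensated process `h (X_n) - h (X_0) - n v`. -/
def compensated {Ω : Type*} (h : ℤ → ℝ) (v : ℝ) (X : ℕ → Ω → ℤ) (n : ℕ) (ω : Ω) : ℝ :=
  h (X n ω) - h (X 0 ω) - n * v

lemma compensated_succ_sub {Ω : Type*} (h : ℤ → ℝ) (v : ℝ) (X : ℕ → Ω → ℤ) (n : ℕ) (ω : Ω) :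
    compensated h v X (n + 1) ω - compensated h v X n ω = h (X (n + 1) ω) - (h (X n ω) + v) := by
  simp only [compensated]
  push_cast
  ring

variable {m : ℕ} [NeZero m] {p : Fin m → ℝ} {Ω : Type*} [MeasurableSpace Ω] {μ : Measure Ω}
  {X : ℕ → Ω → ℤ} {h : ℤ → ℝ} {v c : ℝ}

lemma measurable_history (hX : ∀ n, Measurable (X n)) (n : ℕ) : Measurable (history X n) :=
  measurable_pi_lambda _ fun k => hX k

/-- The filtration generated by the trajectory. -/
def historyFiltration (hX : ∀ n, Measurable (X n)) : Filtration ℕ ‹MeasurableSpace Ω› where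
  seq n := MeasurableSpace.comap (history X n) inferInstance
  mono' i j hij := by
    have e : history X i = (fun y (k : Fin (i + 1)) => y (Fin.castLE (by omega) k)) ∘
        history X j := rfl
    change MeasurableSpace.comap (history X i) inferInstance ≤ _
    rw [e, ← MeasurableSpace.comap_comp]
    exact MeasurableSpace.comap_mono
      (measurable_pi_lambda _ fun k => measurable_pi_apply _).comap_le
  le' n := (measurable_history hX n).comap_le

lemma measurable_compensated (hX : ∀ n, Measurable (X n)) (n : ℕ) :
    Measurable (compensated h v X n) := by
  have (k : ℕ) : Measurable fun ω => h (X k ω) := (Measurable.of_discrete (f := h)).comp (hX k)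
  exact ((this n).sub (this 0)).sub measurable_const

lemma IsCyclicBirthDeathChain.measureReal_history (hX : IsCyclicBirthDeathChain p μ X) (n : ℕ)
    (y : Fin (n + 1) → ℤ) (j : ℤ) :
    μ.real (history X n ⁻¹' {y} ∩ X (n + 1) ⁻¹' {j})
      = μ.real (history X n ⁻¹' {y}) * cyclicTransition p (y (Fin.last n)) j := by
  -- The path `y` is extended by the constant `j`; only its value at time `n + 1` matters.
  have ht := hX.transition n fun k => if hk : k < n + 1 then y ⟨k, hk⟩ else j
  have e1 : {ω | ∀ k ≤ n, X k ω = if hk : k < n + 1 then y ⟨k, hk⟩ else j}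
      = history X n ⁻¹' {y} := by
    ext ω
    simp only [Set.mem_ofPred_eq, Set.mem_preimage, Set.mem_singleton_iff, funext_iff, history]
    constructor
    · intro H k
      have := H k (by omega)
      rwa [dif_pos k.2] at this
    · intro H k hk
      rw [dif_pos (by omega)]
      exact H ⟨k, by omega⟩
  have e2 : {ω | ∀ k ≤ n + 1, X k ω = if hk : k < n + 1 then y ⟨k, hk⟩ else j}
      = history X n ⁻¹' {y} ∩ X (n + 1) ⁻¹' {j} := by
    rw [← e1]
    ext ω
    simp only [Set.mem_ofPred_eq, Set.mem_inter_iff, Set.mem_preimage, Set.mem_singleton_iff]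
    constructor
    · intro H
      exact ⟨fun k hk => H k (by omega), by simpa using H (n + 1) le_rfl⟩
    · rintro ⟨H, H'⟩ k hk
      rcases Nat.lt_or_ge k (n + 1) with hlt | hge
      · exact H k (by omega)
      · obtain rfl : k = n + 1 := by omega
        simpa using H'
  rw [e1, e2] at ht
  simpa [Fin.last] using ht

variable [IsProbabilityMeasure μ]

/-- Each forbidden pair of history and next state is null, and there are only countably many such
pairs. -/
lemma IsCyclicBirthDeathChain.ae_step (hX : IsCyclicBirthDeathChain p μ X) :
    ∀ᵐ ω ∂μ, ∀ n, X (n + 1) ω = X n ω + 1 ∨ X (n + 1) ω = X n ω - 1 := by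
  rw [ae_all_iff]
  intro n
  have H : ∀ᵐ ω ∂μ, ∀ (y : Fin (n + 1) → ℤ) (j : ℤ),
      j ≠ y (Fin.last n) + 1 → j ≠ y (Fin.last n) - 1 →
        ω ∉ history X n ⁻¹' {y} ∩ X (n + 1) ⁻¹' {j} := by
    rw [ae_all_iff]; intro y
    rw [ae_all_iff]; intro j
    by_cases h1 : j = y (Fin.last n) + 1
    · simp [h1]
    by_cases h2 : j = y (Fin.last n) - 1
    · simp [h2]
    have := hX.measureReal_history n y j
    rw [cyclicTransition, if_neg h1, if_neg h2, mul_zero, measureReal_eq_zero_iff] at this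
    filter_upwards [measure_eq_zero_iff_ae_notMem.1 this] with ω hω _ _ using hω
  filter_upwards [H] with ω hω
  by_contra! hcon
  exact hω (history X n ω) (X (n + 1) ω) hcon.1 hcon.2 ⟨rfl, rfl⟩

lemma IsCyclicBirthDeathChain.setIntegral_history (hX : IsCyclicBirthDeathChain p μ X) (n : ℕ)
    (y : Fin (n + 1) → ℤ) (f : ℤ → ℝ) :
    ∫ ω in history X n ⁻¹' {y}, f (X (n + 1) ω) ∂μ = μ.real (history X n ⁻¹' {y}) *
      (cyclicExtension p (y (Fin.last n)) * f (y (Fin.last n) + 1)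
        + (1 - cyclicExtension p (y (Fin.last n))) * f (y (Fin.last n) - 1)) := by
  set l := y (Fin.last n) with hl
  have hA : MeasurableSet (history X n ⁻¹' {y}) :=
    measurable_history hX.measurable n (measurableSet_singleton y)
  have hB (j : ℤ) : MeasurableSet (X (n + 1) ⁻¹' {j}) :=
    hX.measurable (n + 1) (measurableSet_singleton j)
  have e : ∫ ω in history X n ⁻¹' {y}, f (X (n + 1) ω) ∂μ
      = ∫ ω in history X n ⁻¹' {y}, ((X (n + 1) ⁻¹' {l + 1}).indicator (fun _ => f (l + 1)) ω
        + (X (n + 1) ⁻¹' {l - 1}).indicator (fun _ => f (l - 1)) ω) ∂μ := by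
    refine setIntegral_congr_ae hA ?_
    filter_upwards [hX.ae_step] with ω hω hy
    have hXn : X n ω = l := by
      rw [hl, ← (show history X n ω = y from hy)]
      simp [history]
    rcases hω n with h1 | h1 <;> rw [hXn] at h1
    · have : l + 1 ≠ l - 1 := by omega
      simp [h1, this]
    · have : l - 1 ≠ l + 1 := by omega
      simp [h1, this]
  rw [e, integral_add ((integrable_const _).indicator (hB _)) ((integrable_const _).indicator (hB _)),
    integral_indicator_const _ (hB _), integral_indicator_const _ (hB _),
    measureReal_restrict_apply (hB _), measureReal_restrict_apply (hB _), Set.inter_comm,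
    hX.measureReal_history, Set.inter_comm, hX.measureReal_history]
  have : l - 1 ≠ l + 1 := by omega
  simp only [cyclicTransition, ← hl, this, if_true, if_false, smul_eq_mul]
  ring

/-- Increments of the compensated process are orthogonal to functions of the past. -/
lemma IsCyclicBirthDeathChain.integral_history_mul_eq_zero (hX : IsCyclicBirthDeathChain p μ X)
    (hh : ∀ i, cyclicExtension p i * h (i + 1) + (1 - cyclicExtension p i) * h (i - 1) = h i + v)
    (n : ℕ) (G : (Fin (n + 1) → ℤ) → ℝ)
    (hG : Integrable (fun ω => G (history X n ω) *
      (compensated h v X (n + 1) ω - compensated h v X n ω)) μ) :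
    ∫ ω, G (history X n ω) * (compensated h v X (n + 1) ω - compensated h v X n ω) ∂μ = 0 := by
  have hA (y : Fin (n + 1) → ℤ) : MeasurableSet (history X n ⁻¹' {y}) :=
    measurable_history hX.measurable n (measurableSet_singleton y)
  have hU : ⋃ y, history X n ⁻¹' {y} = Set.univ := by
    ext ω; simp
  rw [← setIntegral_univ, ← hU, integral_iUnion hA
    (fun y z hyz => Disjoint.preimage _ (Set.disjoint_singleton.2 hyz)) hG.integrableOn]
  refine (tsum_congr fun y => ?_).trans tsum_zero
  have e : ∫ ω in history X n ⁻¹' {y},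
        G (history X n ω) * (compensated h v X (n + 1) ω - compensated h v X n ω) ∂μ
      = ∫ ω in history X n ⁻¹' {y},
        G y * (h (X (n + 1) ω) - (h (y (Fin.last n)) + v)) ∂μ := by
    refine setIntegral_congr_fun (hA y) fun ω hω => ?_
    have hy : history X n ω = y := hω
    have hXn : X n ω = y (Fin.last n) := by rw [← hy]; simp [history]
    simp only [compensated_succ_sub, hy, hXn]
  rw [e, hX.setIntegral_history n y fun j => G y * (h j - (h (y (Fin.last n)) + v))]
  linear_combination μ.real (history X n ⁻¹' {y}) * G y * hh (y (Fin.last n))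

lemma IsCyclicBirthDeathChain.ae_abs_compensated_succ_sub_le (hX : IsCyclicBirthDeathChain p μ X)
    (hc : ∀ i, |h i - i| ≤ c) :
    ∀ᵐ ω ∂μ, ∀ n, |compensated h v X (n + 1) ω - compensated h v X n ω| ≤ 2 * c + 1 + |v| := by
  filter_upwards [hX.ae_step] with ω hω n
  rw [compensated_succ_sub]
  have h1 := abs_le.1 (hc (X n ω))
  have h2 := abs_le.1 (hc (X (n + 1) ω))
  have h3 := neg_abs_le v
  have h4 := le_abs_self v
  rw [abs_le]
  rcases hω n with e | e <;> rw [e] at h2 ⊢ <;> push_cast at h2 <;> constructor <;> linarith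

lemma IsCyclicBirthDeathChain.ae_abs_compensated_le (hX : IsCyclicBirthDeathChain p μ X)
    (hc : ∀ i, |h i - i| ≤ c) :
    ∀ᵐ ω ∂μ, ∀ n : ℕ, |compensated h v X n ω| ≤ n * (2 * c + 1 + |v|) := by
  filter_upwards [hX.ae_abs_compensated_succ_sub_le hc (v := v)] with ω hω n
  induction n with
  | zero => simp [compensated]
  | succ n ih =>
    have := abs_sub_abs_le_abs_sub (compensated h v X (n + 1) ω) (compensated h v X n ω)
    have := hω n
    push_cast
    linarith

lemma IsCyclicBirthDeathChain.integrable_compensated (hX : IsCyclicBirthDeathChain p μ X)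
    (hc : ∀ i, |h i - i| ≤ c) (n : ℕ) : Integrable (compensated h v X n) μ :=
  Integrable.of_bound (measurable_compensated hX.measurable n).aestronglyMeasurable
    (n * (2 * c + 1 + |v|))
    ((hX.ae_abs_compensated_le hc).mono fun _ hω => hω n)

lemma IsCyclicBirthDeathChain.martingale_compensated (hX : IsCyclicBirthDeathChain p μ X)
    (hh : ∀ i, cyclicExtension p i * h (i + 1) + (1 - cyclicExtension p i) * h (i - 1) = h i + v)
    (hc : ∀ i, |h i - i| ≤ c) :
    Martingale (compensated h v X) (historyFiltration hX.measurable) μ := by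
  have hint (n : ℕ) := hX.integrable_compensated hc (v := v) n
  refine martingale_of_setIntegral_eq_succ (fun n => ?_) hint ?_
  · refine Measurable.stronglyMeasurable ?_
    have e : compensated h v X n
        = (fun y : Fin (n + 1) → ℤ => h (y (Fin.last n)) - h (y 0) - n * v) ∘ history X n := by
      ext ω
      simp [compensated, history]
    rw [e]
    exact Measurable.of_discrete.comp (comap_measurable (history X n))
  · rintro n s ⟨B, hB, rfl⟩
    have hs : MeasurableSet (history X n ⁻¹' B) := measurable_history hX.measurable n hB
    have e : (fun ω => B.indicator (fun _ => (1 : ℝ)) (history X n ω) *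
          (compensated h v X (n + 1) ω - compensated h v X n ω))
        = (history X n ⁻¹' B).indicator (compensated h v X (n + 1) - compensated h v X n) := by
      ext ω
      by_cases hω : history X n ω ∈ B <;> simp [hω]
    have h0 := hX.integral_history_mul_eq_zero hh n (B.indicator fun _ => 1)
      (by rw [e]; exact ((hint _).sub (hint _)).indicator hs)
    rw [e, integral_indicator hs, integral_sub' (hint _).integrableOn (hint _).integrableOn] at h0
    linarith

/-! ### Second moments and the strong law. -/

lemma IsCyclicBirthDeathChain.integral_sq_compensated_le (hX : IsCyclicBirthDeathChain p μ X)
    (hh : ∀ i, cyclicExtension p i * h (i + 1) + (1 - cyclicExtension p i) * h (i - 1) = h i + v)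
    (hc : ∀ i, |h i - i| ≤ c) (n : ℕ) :
    Integrable (fun ω => compensated h v X n ω ^ 2) μ ∧
      ∫ ω, compensated h v X n ω ^ 2 ∂μ ≤ n * (2 * c + 1 + |v|) ^ 2 := by
  set K := 2 * c + 1 + |v| with hK
  have hmeas (n : ℕ) := measurable_compensated hX.measurable (h := h) (v := v) n
  have hsq (n : ℕ) : Integrable (fun ω => compensated h v X n ω ^ 2) μ := by
    refine Integrable.of_bound ((hmeas n).pow_const 2).aestronglyMeasurable ((n * K) ^ 2) ?_
    filter_upwards [hX.ae_abs_compensated_le hc (v := v)] with ω hω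
    rw [norm_pow]
    exact pow_le_pow_left₀ (norm_nonneg _) (hω n) 2
  refine ⟨hsq n, ?_⟩
  induction n with
  | zero => simp [compensated]
  | succ n ih =>
    have hd : Integrable (fun ω =>
        (compensated h v X (n + 1) ω - compensated h v X n ω) ^ 2) μ := by
      refine Integrable.of_bound (((hmeas (n + 1)).sub (hmeas n)).pow_const 2).aestronglyMeasurable
        (K ^ 2) ?_
      filter_upwards [hX.ae_abs_compensated_succ_sub_le hc (v := v)] with ω hω
      rw [norm_pow]
      exact pow_le_pow_left₀ (norm_nonneg _) (hω n) 2
    have hd' : ∫ ω, (compensated h v X (n + 1) ω - compensated h v X n ω) ^ 2 ∂μ ≤ K ^ 2 := by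
      have hle := integral_mono_ae hd (integrable_const (K ^ 2)) (by
        filter_upwards [hX.ae_abs_compensated_succ_sub_le hc (v := v)] with ω hω
        rw [← sq_abs]
        exact pow_le_pow_left₀ (abs_nonneg _) (hω n) 2)
      simpa using hle
    -- Polarization reduces the cross term to squares already known to be integrable.
    have hx : Integrable (fun ω => compensated h v X n ω *
        (compensated h v X (n + 1) ω - compensated h v X n ω)) μ := by
      have : (fun ω => compensated h v X n ω *
          (compensated h v X (n + 1) ω - compensated h v X n ω)) = fun ω =>
          (compensated h v X (n + 1) ω ^ 2 - compensated h v X n ω ^ 2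
            - (compensated h v X (n + 1) ω - compensated h v X n ω) ^ 2) * (1 / 2) := by
        ext ω; ring
      rw [this]
      exact (((hsq _).sub (hsq _)).sub hd).mul_const _
    have hx0 : ∫ ω, compensated h v X n ω *
        (compensated h v X (n + 1) ω - compensated h v X n ω) ∂μ = 0 := by
      have e (ω : Ω) : compensated h v X n ω = (fun y : Fin (n + 1) → ℤ =>
          h (y (Fin.last n)) - h (y 0) - n * v) (history X n ω) := by
        simp [compensated, history]
      have e' : (fun ω => compensated h v X n ω *
          (compensated h v X (n + 1) ω - compensated h v X n ω)) = fun ω =>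
          (fun y : Fin (n + 1) → ℤ => h (y (Fin.last n)) - h (y 0) - n * v) (history X n ω) *
          (compensated h v X (n + 1) ω - compensated h v X n ω) := by
        ext ω; rw [← e]
      rw [e'] at hx ⊢
      exact hX.integral_history_mul_eq_zero hh n
        (fun y => h (y (Fin.last n)) - h (y 0) - n * v) hx
    have e : (fun ω => compensated h v X (n + 1) ω ^ 2) = fun ω =>
        compensated h v X n ω ^ 2 + (2 * (compensated h v X n ω *
          (compensated h v X (n + 1) ω - compensated h v X n ω))
          + (compensated h v X (n + 1) ω - compensated h v X n ω) ^ 2) := by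
      ext ω; ring
    have hx2 := hx.const_mul 2
    rw [e, integral_add (hsq n) (by exact hx2.add hd), integral_add hx2 hd,
      integral_const_mul, hx0]
    push_cast
    linarith

/-- Along squares the normalized second moments are at most `K² / n²`, which is summable; hence the
sum of the squared terms is almost surely finite. -/
lemma IsCyclicBirthDeathChain.ae_tendsto_compensated_sq_div (hX : IsCyclicBirthDeathChain p μ X)
    (hh : ∀ i, cyclicExtension p i * h (i + 1) + (1 - cyclicExtension p i) * h (i - 1) = h i + v)
    (hc : ∀ i, |h i - i| ≤ c) :
    ∀ᵐ ω ∂μ, Tendsto (fun n : ℕ => compensated h v X (n ^ 2) ω / (n : ℝ) ^ 2) atTop (𝓝 0) := by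
  set K := 2 * c + 1 + |v| with hK
  have hmeas (n : ℕ) : Measurable fun ω =>
      ENNReal.ofReal ((compensated h v X (n ^ 2) ω / (n : ℝ) ^ 2) ^ 2) :=
    (((measurable_compensated hX.measurable (n ^ 2)).div_const _).pow_const 2).ennreal_ofReal
  have hbound (n : ℕ) : ∫⁻ ω, ENNReal.ofReal ((compensated h v X (n ^ 2) ω / (n : ℝ) ^ 2) ^ 2) ∂μ
      ≤ ENNReal.ofReal (K ^ 2 * (1 / (n : ℝ) ^ 2)) := by
    obtain ⟨hi, hle⟩ := hX.integral_sq_compensated_le hh hc (n ^ 2)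
    simp only [div_pow]
    rw [← ofReal_integral_eq_lintegral_ofReal (hi.div_const _)
      (Eventually.of_forall fun ω => by positivity), integral_div]
    refine ENNReal.ofReal_le_ofReal ?_
    -- At `n = 0` both sides are 0, as division by zero yields 0.
    rcases Nat.eq_zero_or_pos n with rfl | hn
    · simp
    · have hn' : (0 : ℝ) < n := by exact_mod_cast hn
      rw [div_le_iff₀ (by positivity)]
      refine hle.trans (le_of_eq ?_)
      rw [← hK]
      push_cast
      field_simp
  have hfin : ∫⁻ ω, ∑' n : ℕ,
      ENNReal.ofReal ((compensated h v X (n ^ 2) ω / (n : ℝ) ^ 2) ^ 2) ∂μ ≠ ⊤ := by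
    rw [lintegral_tsum fun n => (hmeas n).aemeasurable]
    refine ne_top_of_le_ne_top ?_ (ENNReal.tsum_le_tsum hbound)
    have hs : Summable fun n : ℕ => K ^ 2 * (1 / (n : ℝ) ^ 2) :=
      (Real.summable_one_div_nat_pow.2 one_lt_two).mul_left _
    rw [← ENNReal.ofReal_tsum_of_nonneg (fun n => by positivity) hs]
    exact ENNReal.ofReal_ne_top
  filter_upwards [ae_lt_top (Measurable.tsum hmeas) hfin] with ω hω
  have h1 := ENNReal.tendsto_atTop_zero_of_tsum_ne_top hω.ne
  have h2 := (ENNReal.tendsto_toReal ENNReal.zero_ne_top).comp h1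
  have h3 : Tendsto (fun n : ℕ => (compensated h v X (n ^ 2) ω / (n : ℝ) ^ 2) ^ 2)
      atTop (𝓝 0) := by
    refine h2.congr fun n => ?_
    simp only [Function.comp]
    exact ENNReal.toReal_ofReal (sq_nonneg _)
  have h4 := h3.sqrt
  simp only [Real.sqrt_sq_eq_abs, Real.sqrt_zero] at h4
  exact (tendsto_zero_iff_abs_tendsto_zero _).2 h4

/-- The strong law of large numbers for a cyclic birth and death chain. -/
theorem IsCyclicBirthDeathChain.ae_tendsto_div (hX : IsCyclicBirthDeathChain p μ X)
    (hh : ∀ i, cyclicExtension p i * h (i + 1) + (1 - cyclicExtension p i) * h (i - 1) = h i + v)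
    (hc : ∀ i, |h i - i| ≤ c) :
    ∀ᵐ ω ∂μ, Tendsto (fun n : ℕ => (X n ω : ℝ) / n) atTop (𝓝 v) := by
  filter_upwards [hX.ae_tendsto_compensated_sq_div hh hc,
    hX.ae_abs_compensated_succ_sub_le hc (v := v)] with ω h1 h2
  have h3 := tendsto_div_of_tendsto_sq (a := fun n => compensated h v X n ω) h2 h1
  -- What separates `X n - n v` from the martingale is bounded in `n`.
  have h4 : Tendsto (fun n : ℕ => (h (X 0 ω) - (h (X n ω) - X n ω)) / (n : ℝ)) atTop (𝓝 0) := by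
    refine squeeze_zero_norm (fun n => ?_)
      (tendsto_const_div_atTop_nhds_zero_nat (|h (X 0 ω)| + c))
    rw [norm_div, Real.norm_natCast]
    gcongr
    exact (abs_sub _ _).trans (by gcongr; exact hc _)
  have h5 := (h3.add h4).add_const v
  rw [add_zero, zero_add] at h5
  refine h5.congr' ?_
  filter_upwards [eventually_ge_atTop 1] with n hn
  have hn' : (n : ℝ) ≠ 0 := by positivity
  simp only [compensated]
  field_simp
  ring

/-! ### Recurrence and conclusion. -/

/-- A cyclic birth and death chain without drift is recurrent. -/
theorem IsCyclicBirthDeathChain.isRecurrentProcess {δ : ℝ} (hX : IsCyclicBirthDeathChain p μ X)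
    (hh : ∀ i, cyclicExtension p i * h (i + 1) + (1 - cyclicExtension p i) * h (i - 1) = h i)
    (hc : ∀ i, |h i - i| ≤ c) (hδ : 0 < δ) (hinc : ∀ i, δ ≤ h (i + 1) - h i) :
    IsRecurrentProcess μ X := by
  have hmart := hX.martingale_compensated (v := 0) (by simpa using hh) hc
  have hbdd := hX.ae_abs_compensated_succ_sub_le hc (v := 0)
  have hmono : Monotone h := monotone_int_of_le_succ fun i => by have := hinc i; linarith
  have hbdd' : ∀ᵐ ω ∂μ, ∀ n, |compensated h 0 X (n + 1) ω - compensated h 0 X n ω| ≤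
      ((2 * c + 1 + |(0 : ℝ)|).toNNReal : NNReal) := by
    filter_upwards [hbdd] with ω hω n using (hω n).trans (Real.le_coe_toNNReal _)
  filter_upwards [hX.ae_step, hmart.submartingale.bddAbove_iff_exists_tendsto hbdd',
    hmart.bddAbove_range_iff_bddBelow_range hbdd'] with ω hstep hconv hab
  -- Boundedness above would force convergence, but consecutive values differ by at least `δ`.
  have hnot : ¬ BddAbove (Set.range fun n => compensated h 0 X n ω) := by
    intro H
    obtain ⟨a, ha⟩ := hconv.1 H
    have h1 := ((ha.comp (tendsto_add_atTop_nat 1)).sub ha).abs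
    rw [sub_self, abs_zero] at h1
    refine hδ.not_ge (ge_of_tendsto' h1 fun n => ?_)
    simp only [Function.comp, compensated_succ_sub, add_zero]
    rcases hstep n with e | e <;> rw [e]
    · exact (hinc _).trans (le_abs_self _)
    · have := hinc (X n ω - 1)
      rw [sub_add_cancel] at this
      rw [abs_sub_comm]
      exact this.trans (le_abs_self _)
  -- Monotonicity of `h` carries a bound on the path over to the martingale; a lower bound is turned
  -- into an upper one by `hab`.
  refine Int.frequently_eq_zero_of_unbounded hstep ?_ ?_
  · rintro ⟨b, hb⟩
    refine hnot ⟨h b - h (X 0 ω), ?_⟩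
    rintro _ ⟨n, rfl⟩
    have := hmono (hb ⟨n, rfl⟩)
    simpa [compensated] using this
  · rintro ⟨b, hb⟩
    refine hnot (hab.2 ⟨h b - h (X 0 ω), ?_⟩)
    rintro _ ⟨n, rfl⟩
    have := hmono (hb ⟨n, rfl⟩)
    simpa [compensated] using this

end Chain

theorem proposition1p1 {m : ℕ} [NeZero m] (p : Fin m → ℝ) (hp : ∀ i, p i ∈ Set.Ioo (0 : ℝ) 1) :
    ∃ v : ℝ,
      (0 < v ↔ cyclicGamma p < 1) ∧
      (v < 0 ↔ 1 < cyclicGamma p) ∧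
      ∀ (Ω : Type*) [MeasurableSpace Ω] (μ : Measure Ω) [IsProbabilityMeasure μ]
        (X : ℕ → Ω → ℤ), IsCyclicBirthDeathChain p μ X →
          (∀ᵐ ω ∂μ, Tendsto (fun n : ℕ => (X n ω : ℝ) / n) atTop (𝓝 v)) ∧
          ((v = 0 ∧ IsRecurrentProcess μ X) ↔ cyclicGamma p = 1) := by
  obtain ⟨h, v, δ, c, hpos, hneg, hh, hδ, hinc, hc⟩ := exists_harmonic_coordinate hp
  refine ⟨v, hpos, hneg, fun Ω _ μ _ X hX => ⟨hX.ae_tendsto_div hh hc, ?_, ?_⟩⟩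
  · rintro ⟨rfl, -⟩
    exact le_antisymm (not_lt.1 fun H => lt_irrefl _ (hneg.2 H))
      (not_lt.1 fun H => lt_irrefl _ (hpos.2 H))
  · intro hγ
    have hv : v = 0 := le_antisymm (not_lt.1 fun H => (hpos.1 H).ne hγ)
      (not_lt.1 fun H => (hneg.1 H).ne' hγ)
    subst hv
    exact ⟨rfl, hX.isRecurrentProcess (by simpa using hh) hc hδ hinc⟩
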